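/- Let $\Omega\subset\mathbb{R}^n$ be a bounded open set with Lipschitz boundary (near each point of $\partial\Omega$, after a rotation of the coordinates, $\Omega$ is the set of points lying strictly below the graph of a Lipschitz function of $n-1$ variables), and let $\lambda\in\mathbb{R}^n$ be a nonzero constant vector. For vectors $a,b\in\mathbb{R}^n$ and a vector field $\omega=(\omega_1,\dots,\omega_n)$ let $a\times b$ and $\operatorname{curl}\omega$ be the vectors in $\mathbb{R}^{\binom n2}$ with components $$(a\times b)_{ij}=a_ib_j-a_jb_i,\qquad (\operatorname{curl}\omega)_{ij}=\frac{\partial\omega_j}{\partial x_i}-\frac{\partial\omega_i}{\partial x_j},\qquad 1\le i<j\le n,$$ let $\operatorname{div}\omega=\sum_{i=1}^n\partial\omega_i/\partial x_i$, and let $|\nabla\omega|^2=\sum_{i,j=1}^n(\partial\omega_i/\partial x_j)^2$. Then for every $\omega\in C^1(\overline\Omega)^n$ (that is, $\omega$ is continuous on $\overline\Omega$ and differentiable in $\Omega$, and its first derivatives in $\Omega$ extend continuously to $\overline\Omega$) with $\lambda\times\omega=0$ on $\partial\Omega$, both integrals below are finite and $$\int_\Omega|\nabla\omega|^2\,dx=\int_\Omega\left(|\operatorname{curl}\omega|^2+|\operatorname{div}\omega|^2\right)dx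 .$$ -/

import Mathlib

open MeasureTheory

noncomputable section

namespace Gaffney

/-- `ℝⁿ` with its Euclidean norm. -/
abbrev Space (n : ℕ) : Type := EuclideanSpace ℝ (Fin n)

/-- The index set of the pairs `i < j`; it has `n.choose 2` elements. -/
abbrev Pairs (n : ℕ) : Type := {p : Fin n × Fin n // p.1 < p.2}

/-- The cross product of two vectors of `ℝⁿ`, a vector indexed by the pairs `i < j`:
`(a × b)_{ij} = a_i b_j - a_j b_i`. -/
def cross {n : ℕ} (a b : Space n) : EuclideanSpace ℝ (Pairs n) :=
  WithLp.toLp 2 fun p => a p.1.1 * b p.1.2 - a p.1.2 * b p.1.1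

/-- The partial derivative `∂ω_i/∂x_j` at `x` of the vector field `ω`. -/
def partialDeriv {n : ℕ} (ω : Space n → Space n) (i j : Fin n) (x : Space n) : ℝ :=
  fderiv ℝ ω x (EuclideanSpace.single j 1) i

/-- The gradient `∇ω(x)`, the matrix `(∂ω_i/∂x_j)_{ij}`; its norm is the Euclidean norm of
the `n²` entries. -/
def grad {n : ℕ} (ω : Space n → Space n) (x : Space n) : EuclideanSpace ℝ (Fin n × Fin n) :=
  WithLp.toLp 2 fun p => partialDeriv ω p.1 p.2 x

/-- The curl, a vector indexed by the pairs `i < j`: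
`(curl ω)_{ij} = ∂ω_j/∂x_i - ∂ω_i/∂x_j`. -/
def curl {n : ℕ} (ω : Space n → Space n) (x : Space n) : EuclideanSpace ℝ (Pairs n) :=
  WithLp.toLp 2 fun p => partialDeriv ω p.1.2 p.1.1 x - partialDeriv ω p.1.1 p.1.2 x

/-- The divergence `∑ i, ∂ω_i/∂x_i`. -/
def divergence {n : ℕ} (ω : Space n → Space n) (x : Space n) : ℝ :=
  ∑ i, partialDeriv ω i i x

/-- `∂Ω` is Lipschitz: near every boundary point, and up to a choice of the vertical direction
`v` (a unit vector), `Ω` is the set of the points lying strictly below the graph of a Lipschitz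
function on the hyperplane orthogonal to `v`. -/
def HasLipschitzBoundary {n : ℕ} (Ω : Set (Space n)) : Prop :=
  ∀ x ∈ frontier Ω, ∃ v : Space n, ‖v‖ = 1 ∧
    ∃ (K : NNReal) (φ : (Submodule.span ℝ {v})ᗮ → ℝ) (U : Set (Space n)),
      LipschitzWith K φ ∧ IsOpen U ∧ x ∈ U ∧
        ∀ y ∈ U, y ∈ Ω ↔ inner ℝ v y < φ ((Submodule.span ℝ {v})ᗮ.orthogonalProjectionOnto y)

/-- `ω ∈ C¹(Ω̄)ⁿ`, for an open set `Ω`: `ω` is continuous on `Ω̄` and differentiable in `Ω`, and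
its derivative in `Ω` is the restriction of a map that is continuous on `Ω̄`. The values of `ω`
outside `Ω̄` play no role. -/
def IsC1OnClosure {n : ℕ} (Ω : Set (Space n)) (ω : Space n → Space n) : Prop :=
  ContinuousOn ω (closure Ω) ∧
    ∃ D : Space n → (Space n →L[ℝ] Space n),
      ContinuousOn D (closure Ω) ∧ ∀ x ∈ Ω, HasFDerivAt ω (D x) x

end Gaffney

end

/-!
With `A = ∇ω`, the difference `|∇ω|² - |curl ω|² - |div ω|²` is pointwise the null Lagrangian
`Q(A) = tr (A²) - (tr A)²` (`sum_sq_eq_curl_add_div`), so its integral has to be shown to vanish.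
The boundary condition says that `ω` is parallel to `l` on `∂Ω`, that is, the component `η` of `ω`
orthogonal to `l` vanishes there. Write `ω = q l + η`, with a scalar function `q`. As `Q` vanishes
on the rank-one matrix `l ⊗ ∇q`, polarization turns `Q(∇ω)` into `B(∇(ω + q l), ∇η)`, with `B` the
bilinear form of `Q` (`sum_null_lagrangian_polarized`). This is a sum of terms
`∂ᵢu ∂ⱼw - ∂ⱼu ∂ᵢw` in which the factor `u`, a component of `η`, vanishes on `∂Ω`; no rotation of
the coordinates is involved.

The integral of each of these terms vanishes (`setIntegral_wedge_eq_zero`). For compactly supported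
functions this is integration by parts, done with difference quotients since the functions are only
`C¹` (`integral_fderiv_mul_fderiv_comm`). For `u` vanishing on `∂Ω` one truncates `u` near its zero
set, so that it becomes compactly supported in `Ω` (`setIntegral_cutoff_mul_wedge_eq_zero`), and
removes the truncation by dominated convergence; the zero set of `u` contributes nothing because the
derivative of `u` vanishes almost everywhere on it (`ae_fderiv_eq_zero_of_eq_zero`).
-/

namespace Gaffney

open Filter Set Topology

/-! ### Integration by parts for compactly supported functions -/

section Wedge

variable {E : Type*} [NormedAddCommGroup E] [NormedSpace ℝ E] [FiniteDimensional ℝ E]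
  [MeasurableSpace E] [BorelSpace E] {μ : Measure E} [μ.IsAddHaarMeasure]

/-- The integral of `(du ∧ dw)(a, b)` over the whole space vanishes for compactly supported `C¹`
functions. Integrating by parts twice would need second derivatives; instead `∂_a u` is replaced by
a difference quotient, which commutes with `∂_b` and is transferred to `w` by a translation of the
variable. -/
theorem integral_fderiv_mul_fderiv_comm {u w : E → ℝ} (hu : ContDiff ℝ 1 u)
    (hw : ContDiff ℝ 1 w) (hcu : HasCompactSupport u) (hcw : HasCompactSupport w) (a b : E) :
    ∫ x, fderiv ℝ u x a * fderiv ℝ w x b ∂μ = ∫ x, fderiv ℝ u x b * fderiv ℝ w x a ∂μ := by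
  obtain ⟨Cu, hLu⟩ := hu.lipschitzWith_of_hasCompactSupport hcu one_ne_zero
  obtain ⟨Cw, hLw⟩ := hw.lipschitzWith_of_hasCompactSupport hcw one_ne_zero
  have hdu : Differentiable ℝ u := hu.differentiable one_ne_zero
  have hdw : Differentiable ℝ w := hw.differentiable one_ne_zero
  have hub : Continuous fun x => fderiv ℝ u x b := (hu.continuous_fderiv one_ne_zero).clm_apply
    continuous_const
  have hwb : Continuous fun x => fderiv ℝ w x b := (hw.continuous_fderiv one_ne_zero).clm_apply
    continuous_const
  have hiub : Integrable (fun x => fderiv ℝ u x b) μ :=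
    hub.integrable_of_hasCompactSupport (hcu.fderiv_apply ℝ b)
  have hiwb : Integrable (fun x => fderiv ℝ w x b) μ :=
    hwb.integrable_of_hasCompactSupport (hcw.fderiv_apply ℝ b)
  have key : ∀ t : ℝ, ∫ x, (t⁻¹ • (u (x + t • a) - u x)) * fderiv ℝ w x b ∂μ =
      -∫ x, (t⁻¹ • (w (x + t • (-a)) - w x)) * fderiv ℝ u x b ∂μ := by
    intro t
    have hh : ContDiff ℝ 1 fun x => t⁻¹ • (u (x + t • a) - u x) := by fun_prop
    have hch : HasCompactSupport fun x => t⁻¹ • (u (x + t • a) - u x) := by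
      have h1 : HasCompactSupport fun x => u (x + t • a) :=
        hcu.comp_homeomorph (Homeomorph.addRight (t • a))
      exact (h1.sub hcu).smul_left (f := fun _ => t⁻¹)
    obtain ⟨Ch, hLh⟩ := hh.lipschitzWith_of_hasCompactSupport hch one_ne_zero
    have h1 := LipschitzWith.integral_lineDeriv_mul_eq (μ := μ) hLw hLh hch b
    have h2 : ∀ x, lineDeriv ℝ (fun x => t⁻¹ • (u (x + t • a) - u x)) x (-b) =
        -(t⁻¹ * (fderiv ℝ u (x + t • a) b - fderiv ℝ u x b)) := by
      intro x
      rw [(hh.differentiable one_ne_zero x).lineDeriv_eq_fderiv, map_neg]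
      have : HasFDerivAt (fun x => t⁻¹ • (u (x + t • a) - u x))
          (t⁻¹ • (fderiv ℝ u (x + t • a) - fderiv ℝ u x)) x := by
        refine (HasFDerivAt.sub ?_ (hdu x).hasFDerivAt).const_smul t⁻¹
        exact (hasFDerivAt_comp_add_right (t • a)).2 (hdu (x + t • a)).hasFDerivAt
      rw [this.fderiv]
      simp
    simp only [h2, (hdw _).lineDeriv_eq_fderiv] at h1
    simp only [mul_comm (t⁻¹ • _)] at h1 ⊢
    rw [h1, ← integral_neg]
    have i1 : Integrable (fun x => fderiv ℝ u (x + t • a) b * w x) μ :=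
      ((by fun_prop : Continuous fun x => fderiv ℝ u (x + t • a) b).mul
        hw.continuous).integrable_of_hasCompactSupport hcw.mul_left
    have i2 : Integrable (fun x => fderiv ℝ u x b * w x) μ :=
      (hub.mul hw.continuous).integrable_of_hasCompactSupport hcw.mul_left
    have i3 : Integrable (fun x => fderiv ℝ u x b * w (x + t • (-a))) μ :=
      (hub.mul (by fun_prop)).integrable_of_hasCompactSupport (hcu.fderiv_apply ℝ b).mul_right
    have e1 : ∫ x, fderiv ℝ u (x + t • a) b * w x ∂μ =
        ∫ x, fderiv ℝ u x b * w (x + t • (-a)) ∂μ := by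
      rw [← integral_add_right_eq_self (μ := μ) (fun x => fderiv ℝ u x b * w (x + t • (-a)))
        (t • a)]
      simp
    calc ∫ x, -(t⁻¹ * (fderiv ℝ u (x + t • a) b - fderiv ℝ u x b)) * w x ∂μ
        = ∫ x, (-t⁻¹) * (fderiv ℝ u (x + t • a) b * w x - fderiv ℝ u x b * w x) ∂μ := by
          congr 1; ext x; ring
      _ = ∫ x, (-t⁻¹) * (fderiv ℝ u x b * w (x + t • (-a)) - fderiv ℝ u x b * w x) ∂μ := by
          rw [integral_const_mul, integral_const_mul, integral_sub i1 i2, integral_sub i3 i2, e1]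
      _ = _ := by congr 1; ext x; simp only [smul_eq_mul]; ring
  have l1 := hLu.integral_inv_smul_sub_mul_tendsto_integral_lineDeriv_mul hiwb a
  have l2 := (hLw.integral_inv_smul_sub_mul_tendsto_integral_lineDeriv_mul hiub (-a)).neg
  simp only [key] at l1
  have := tendsto_nhds_unique l1 l2
  simp only [(hdu _).lineDeriv_eq_fderiv, (hdw _).lineDeriv_eq_fderiv] at this
  rw [this, ← integral_neg]
  congr 1; ext x; simp; ring

/-- The derivative of a function vanishes almost everywhere on its zero set: it does so at the
Lebesgue density points. Mathlib has the corresponding statement for maps `E → E`, which is applied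
to `u • v` for a fixed vector `v ≠ 0`. -/
theorem ae_fderiv_eq_zero_of_eq_zero {s : Set E} (hs : MeasurableSet s) {u : E → ℝ}
    {u' : E → E →L[ℝ] ℝ} (hu : ∀ x ∈ s, HasFDerivAt u (u' x) x) (h0 : ∀ x ∈ s, u x = 0) :
    ∀ᵐ x ∂μ.restrict s, u' x = 0 := by
  rcases subsingleton_or_nontrivial E with hE | hE
  · exact Eventually.of_forall fun x => Subsingleton.elim _ _
  obtain ⟨v, hv⟩ := exists_ne (0 : E)
  have hA : ApproximatesLinearOn (fun x => u x • v) (0 : E →L[ℝ] E) s 0 := by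
    intro x hx y hy
    simp [h0 x hx, h0 y hy]
  filter_upwards [hA.norm_fderiv_sub_le μ hs (fun x => (u' x).smulRight v)
    fun x hx => ((hu x hx).smul_const v).hasFDerivWithinAt] with x hx
  simpa [hv] using hx

end Wedge

/-! ### Truncation near the zero set -/

theorem contDiff_indicator_of_eq_zero_off {E : Type*} [NormedAddCommGroup E] [NormedSpace ℝ E]
    {Ω K : Set E} (hΩ : IsOpen Ω) (hK : IsClosed K)
    (hKΩ : K ⊆ Ω) {f : E → ℝ} (hf : ContDiffOn ℝ 1 f Ω) (h0 : ∀ x ∈ Ω \ K, f x = 0) :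
    ContDiff ℝ 1 (Ω.indicator f) := by
  rw [contDiff_iff_contDiffAt]
  intro x
  by_cases hx : x ∈ Ω
  · refine (hf.contDiffAt (hΩ.mem_nhds hx)).congr_of_eventuallyEq ?_
    filter_upwards [hΩ.mem_nhds hx] with y hy using indicator_of_mem hy f
  · refine (contDiffAt_const (c := (0 : ℝ))).congr_of_eventuallyEq ?_
    filter_upwards [hK.isOpen_compl.mem_nhds fun h => hx (hKΩ h)] with y hy
    by_cases hy' : y ∈ Ω
    · rw [indicator_of_mem hy', h0 y ⟨hy', hy⟩]
    · exact indicator_of_notMem hy' f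

/-- A smooth function of `t` with values in `[0, 1]` that vanishes for `|k t| ≤ 1` and equals `1` as
soon as `(k t)² ≥ 2`. -/
noncomputable def cutoff (k : ℕ) (t : ℝ) : ℝ := Real.smoothTransition ((k * t) ^ 2 - 1)

theorem contDiff_cutoff (k : ℕ) : ContDiff ℝ 1 (cutoff k) :=
  (Real.smoothTransition.contDiff (n := 1)).comp (by fun_prop)

theorem cutoff_nonneg (k : ℕ) (t : ℝ) : 0 ≤ cutoff k t := Real.smoothTransition.nonneg _

theorem cutoff_le_one (k : ℕ) (t : ℝ) : cutoff k t ≤ 1 := Real.smoothTransition.le_one _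

theorem cutoff_eq_zero {k : ℕ} {t : ℝ} (h : |t| < ((k : ℝ) + 1)⁻¹) : cutoff k t = 0 := by
  apply Real.smoothTransition.zero_of_nonpos
  have hk : (0 : ℝ) < k + 1 := by positivity
  have h1 : |k * t| ≤ 1 := by
    rw [abs_mul, Nat.abs_cast]
    calc (k : ℝ) * |t| ≤ (k + 1) * ((k : ℝ) + 1)⁻¹ := by gcongr; simp
      _ = 1 := mul_inv_cancel₀ hk.ne'
  linarith [(sq_le_one_iff_abs_le_one _).2 h1]

theorem eventually_cutoff_eq_one {t : ℝ} (ht : t ≠ 0) : ∀ᶠ k : ℕ in atTop, cutoff k t = 1 := by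
  filter_upwards [eventually_ge_atTop ⌈2 / |t|⌉₊] with k hk
  apply Real.smoothTransition.one_of_one_le
  have ht' : 0 < |t| := abs_pos.2 ht
  have h2 : 2 ≤ k * |t| := (div_le_iff₀ ht').1 (Nat.ceil_le.1 hk)
  have h3 : (k * t) ^ 2 = (k * |t|) ^ 2 := by rw [mul_pow, mul_pow, sq_abs]
  rw [h3]
  nlinarith

theorem hasDerivAt_integral_of_continuous {H : ℝ → ℝ} (hH : Continuous H) (t : ℝ) :
    HasDerivAt (fun t => ∫ s in (0 : ℝ)..t, H s) (H t) t :=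
  intervalIntegral.integral_hasDerivAt_right (hH.intervalIntegrable _ _)
    hH.stronglyMeasurable.stronglyMeasurableAtFilter hH.continuousAt

theorem contDiffOn_one_of_hasFDerivAt {E : Type*} [NormedAddCommGroup E] [NormedSpace ℝ E]
    {Ω : Set E} (hΩ : IsOpen Ω) {u : E → ℝ} {u' : E → E →L[ℝ] ℝ} (hc : ContinuousOn u' Ω)
    (hu : ∀ x ∈ Ω, HasFDerivAt u (u' x) x) : ContDiffOn ℝ 1 u Ω := by
  refine (contDiffOn_succ_iff_fderiv_of_isOpen (n := 0) hΩ).2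
    ⟨fun x hx => (hu x hx).differentiableAt.differentiableWithinAt, by simp, ?_⟩
  exact contDiffOn_zero.2 (hc.congr fun x hx => (hu x hx).fderiv)

/-! ### Integration by parts for a factor that vanishes on the boundary -/

section Wedge

variable {E : Type*} [NormedAddCommGroup E] [NormedSpace ℝ E] [FiniteDimensional ℝ E]
  [MeasurableSpace E] [BorelSpace E] {μ : Measure E} [μ.IsAddHaarMeasure]

/-- If `u = 0` on `∂Ω` and `H` vanishes near `0`, then `H(u)² du ∧ dw` has integral zero over `Ω`.
Indeed `H(u)² du ∧ dw = d(F(u)) ∧ d(H(u) w)` for a primitive `F` of `H`, because `du ∧ du = 0`, and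
both `F(u)` and `H(u) w` have compact support in `Ω`. -/
theorem setIntegral_cutoff_mul_wedge_eq_zero {Ω : Set E} (hΩ : IsOpen Ω)
    (hb : Bornology.IsBounded Ω) {u w : E → ℝ} (huc : ContinuousOn u (closure Ω))
    (hu0 : ∀ x ∈ frontier Ω, u x = 0) (hu : ContDiffOn ℝ 1 u Ω) (hw : ContDiffOn ℝ 1 w Ω)
    {H : ℝ → ℝ} (hH : ContDiff ℝ 1 H) {δ : ℝ} (hδ : 0 < δ) (hH0 : ∀ t, |t| < δ → H t = 0)
    (a b : E) :
    ∫ x in Ω, H (u x) ^ 2 *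
      (fderiv ℝ u x a * fderiv ℝ w x b - fderiv ℝ u x b * fderiv ℝ w x a) ∂μ = 0 := by
  set F : ℝ → ℝ := fun t => ∫ s in (0 : ℝ)..t, H s with hF
  have hF' : ∀ t, HasDerivAt F (H t) t := hasDerivAt_integral_of_continuous hH.continuous
  have hFc : ContDiff ℝ 1 F := by
    rw [contDiff_one_iff_deriv, funext fun t => (hF' t).deriv]
    exact ⟨fun t => (hF' t).differentiableAt, hH.continuous⟩
  have hF0 : ∀ t, |t| < δ → F t = 0 := by
    intro t ht
    rw [hF]
    refine intervalIntegral.integral_zero_ae (Eventually.of_forall fun s hs => hH0 s ?_)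
    have := abs_sub_left_of_mem_uIcc (uIoc_subset_uIcc hs)
    simp only [sub_zero] at this
    exact this.trans_lt ht
  -- This set is compact and, as `u = 0` on `∂Ω`, contained in `Ω`; it carries the supports of
  -- `U` and `W` below.
  set K : Set E := closure Ω ∩ (fun x => |u x|) ⁻¹' Ici δ
  have hK : IsClosed K := huc.abs.preimage_isClosed_of_isClosed isClosed_closure isClosed_Ici
  have hKc : IsCompact K := hb.isCompact_closure.of_isClosed_subset hK inter_subset_left
  have hKΩ : K ⊆ Ω := by
    rintro x ⟨hx, hx'⟩
    by_contra hxΩ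
    have : u x = 0 := hu0 x (by rw [hΩ.frontier_eq]; exact ⟨hx, hxΩ⟩)
    simp only [mem_preimage, this, abs_zero, mem_Ici] at hx'
    exact hx'.not_gt hδ
  have hoff : ∀ x ∈ Ω \ K, |u x| < δ := fun x hx => by
    by_contra h
    exact hx.2 ⟨subset_closure hx.1, not_lt.1 h⟩
  set U : E → ℝ := Ω.indicator fun x => F (u x) with hU
  set W : E → ℝ := Ω.indicator fun x => H (u x) * w x with hW
  have hUc : ContDiff ℝ 1 U := contDiff_indicator_of_eq_zero_off hΩ hK hKΩ
    (hFc.comp_contDiffOn hu) fun x hx => hF0 _ (hoff x hx)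
  have hWc : ContDiff ℝ 1 W := contDiff_indicator_of_eq_zero_off hΩ hK hKΩ
    ((hH.comp_contDiffOn hu).mul hw) fun x hx => by simp [hH0 _ (hoff x hx)]
  have hU0 : ∀ x ∉ K, U x = 0 := fun x hx => by
    by_cases h : x ∈ Ω
    · rw [hU, indicator_of_mem h, hF0 _ (hoff x ⟨h, hx⟩)]
    · exact indicator_of_notMem h _
  have hW0 : ∀ x ∉ K, W x = 0 := fun x hx => by
    by_cases h : x ∈ Ω
    · rw [hW, indicator_of_mem h, hH0 _ (hoff x ⟨h, hx⟩), zero_mul]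
    · exact indicator_of_notMem h _
  have hUs : HasCompactSupport U := HasCompactSupport.intro hKc hU0
  have hWs : HasCompactSupport W := HasCompactSupport.intro hKc hW0
  have hUt : tsupport U ⊆ Ω := (closure_minimal (fun x hx => by
    by_contra h; exact hx (hU0 x h)) hK).trans hKΩ
  have hint : ∀ c d : E, Integrable (fun x => fderiv ℝ U x c * fderiv ℝ W x d) μ := fun c d =>
    (((hUc.continuous_fderiv one_ne_zero).clm_apply (continuous_const (y := c))).mul
      ((hWc.continuous_fderiv one_ne_zero).clm_apply
        (continuous_const (y := d)))).integrable_of_hasCompactSupport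
          (hUs.fderiv_apply ℝ c).mul_right
  have hzero : ∫ x, (fderiv ℝ U x a * fderiv ℝ W x b - fderiv ℝ U x b * fderiv ℝ W x a) ∂μ = 0 := by
    rw [integral_sub (hint a b) (hint b a), integral_fderiv_mul_fderiv_comm hUc hWc hUs hWs,
      sub_self]
  rw [← setIntegral_eq_integral_of_forall_compl_eq_zero (s := Ω) fun x hx => by
    rw [fderiv_of_notMem_tsupport (𝕜 := ℝ) fun h => hx (hUt h)]
    simp] at hzero
  rw [← hzero]
  refine setIntegral_congr_fun hΩ.measurableSet fun x hx => ?_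
  have hux : HasFDerivAt u (fderiv ℝ u x) x :=
    ((hu.contDiffAt (hΩ.mem_nhds hx)).differentiableAt one_ne_zero).hasFDerivAt
  have hwx : HasFDerivAt w (fderiv ℝ w x) x :=
    ((hw.contDiffAt (hΩ.mem_nhds hx)).differentiableAt one_ne_zero).hasFDerivAt
  have hUx : fderiv ℝ U x = H (u x) • fderiv ℝ u x := by
    refine (((hF' (u x)).comp_hasFDerivAt x hux).congr_of_eventuallyEq ?_).fderiv
    filter_upwards [hΩ.mem_nhds hx] with y hy using indicator_of_mem hy _
  have hWx : fderiv ℝ W x = H (u x) • fderiv ℝ w x + w x • deriv H (u x) • fderiv ℝ u x := by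
    refine ((((hH.differentiable one_ne_zero (u x)).hasDerivAt.comp_hasFDerivAt x hux).mul
      hwx).congr_of_eventuallyEq ?_).fderiv
    filter_upwards [hΩ.mem_nhds hx] with y hy using indicator_of_mem hy _
  simp only [hUx, hWx, add_apply, smul_apply,
    smul_eq_mul]
  ring

/-- The integral of `(du ∧ dw)(a, b)` over `Ω` vanishes if `u` and `w` are `C¹` up to the boundary
and `u` vanishes there: the truncation factors `cutoff k ∘ u` tend to `1` off the zero set of `u`,
and `du = 0` almost everywhere on it. -/
theorem setIntegral_wedge_eq_zero {Ω : Set E} (hΩ : IsOpen Ω) (hb : Bornology.IsBounded Ω)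
    {u w : E → ℝ} {u' w' : E → E →L[ℝ] ℝ} (huc : ContinuousOn u (closure Ω))
    (hu0 : ∀ x ∈ frontier Ω, u x = 0) (hu'c : ContinuousOn u' (closure Ω))
    (hw'c : ContinuousOn w' (closure Ω)) (hu : ∀ x ∈ Ω, HasFDerivAt u (u' x) x)
    (hw : ∀ x ∈ Ω, HasFDerivAt w (w' x) x) (a b : E) :
    ∫ x in Ω, (u' x a * w' x b - u' x b * w' x a) ∂μ = 0 := by
  set g : E → ℝ := fun x => u' x a * w' x b - u' x b * w' x a with hg
  have hgc : ContinuousOn g (closure Ω) :=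
    ((hu'c.clm_apply continuousOn_const).mul (hw'c.clm_apply continuousOn_const)).sub
      ((hu'c.clm_apply continuousOn_const).mul (hw'c.clm_apply continuousOn_const))
  have hgi : IntegrableOn g Ω μ :=
    (hgc.integrableOn_compact hb.isCompact_closure).mono_set subset_closure
  have huΩ := huc.mono (subset_closure (s := Ω))
  have hcut : ∀ k : ℕ, ∫ x in Ω, cutoff k (u x) ^ 2 * g x ∂μ = 0 := by
    intro k
    rw [← setIntegral_cutoff_mul_wedge_eq_zero (μ := μ) hΩ hb huc hu0
      (contDiffOn_one_of_hasFDerivAt hΩ (hu'c.mono subset_closure) hu)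
      (contDiffOn_one_of_hasFDerivAt hΩ (hw'c.mono subset_closure) hw)
      (contDiff_cutoff k) (by positivity : (0 : ℝ) < ((k : ℝ) + 1)⁻¹)
      (fun _ => cutoff_eq_zero) a b]
    refine setIntegral_congr_fun hΩ.measurableSet fun x hx => ?_
    simp only [hg, (hu x hx).fderiv, (hw x hx).fderiv]
  have hZ : MeasurableSet (Ω ∩ u ⁻¹' {0}) := by
    have h : Ω ∩ u ⁻¹' {0} = Ω \ (Ω ∩ u ⁻¹' {0}ᶜ) := by ext x; simp +contextual
    rw [h]
    exact hΩ.measurableSet.diff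
      (huΩ.isOpen_inter_preimage hΩ isOpen_compl_singleton).measurableSet
  have hae := (ae_restrict_iff' hZ).1 (ae_fderiv_eq_zero_of_eq_zero (μ := μ) hZ
    (fun x hx => hu x hx.1) fun x hx => hx.2)
  have hlim : Tendsto (fun k : ℕ => ∫ x in Ω, cutoff k (u x) ^ 2 * g x ∂μ) atTop
      (𝓝 (∫ x in Ω, g x ∂μ)) := by
    refine tendsto_integral_of_dominated_convergence (fun x => ‖g x‖) ?_ hgi.norm ?_ ?_
    · intro k
      refine ContinuousOn.aestronglyMeasurable ?_ hΩ.measurableSet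
      exact (((contDiff_cutoff k).continuous.comp_continuousOn huΩ).pow 2).mul
        (hgc.mono subset_closure)
    · intro k
      refine Eventually.of_forall fun x => ?_
      rw [norm_mul, norm_pow, Real.norm_of_nonneg (cutoff_nonneg k _)]
      exact mul_le_of_le_one_left (norm_nonneg _)
        (pow_le_one₀ (cutoff_nonneg k _) (cutoff_le_one k _))
    · rw [ae_restrict_iff' hΩ.measurableSet]
      filter_upwards [hae] with x hx hxΩ
      by_cases h0 : u x = 0
      · simp [hg, hx ⟨hxΩ, h0⟩]
      · refine tendsto_const_nhds.congr' ?_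
        filter_upwards [eventually_cutoff_eq_one h0] with k hk
        simp [hk]
  simp only [hcut] at hlim
  exact (tendsto_nhds_unique hlim tendsto_const_nhds)

end Wedge

/-! ### Pointwise algebra of the gradient, the curl and the divergence -/

theorem sum_pairs {n : ℕ} (f : Fin n → Fin n → ℝ) (hs : ∀ i j, f i j = f j i)
    (hd : ∀ i, f i i = 0) :
    2 * ∑ p : Pairs n, f p.1.1 p.1.2 = ∑ i, ∑ j, f i j := by
  have h1 : ∑ p : Pairs n, f p.1.1 p.1.2 = ∑ i, ∑ j, if i < j then f i j else 0 := by
    rw [← Fintype.sum_prod_type' (f := fun i j => if i < j then f i j else 0),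
      ← Finset.sum_filter]
    exact (Finset.sum_subtype _ (by simp) fun p : Fin n × Fin n => f p.1 p.2).symm
  have h2 : ∑ i, ∑ j, (if i < j then f i j else 0) = ∑ i, ∑ j, if j < i then f i j else 0 := by
    rw [Finset.sum_comm]
    simp only [hs]
  have h3 : ∀ i j, f i j = (if i < j then f i j else 0) + if j < i then f i j else 0 := by
    intro i j
    rcases lt_trichotomy i j with h | rfl | h
    · simp [h, h.not_gt]
    · simp [hd]
    · simp [h, h.not_gt]
  rw [two_mul, h1]
  nth_rewrite 2 [h2]
  simp only [← Finset.sum_add_distrib, ← h3]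

/-- The pointwise identity `|A|² = |curl|² + (tr A)² + (tr (A²) - (tr A)²)`, for a gradient
matrix `A`. -/
theorem sum_sq_eq_curl_add_div {n : ℕ} (A : Fin n → Fin n → ℝ) :
    ∑ i, ∑ j, A i j ^ 2 = ∑ p : Pairs n, (A p.1.2 p.1.1 - A p.1.1 p.1.2) ^ 2 + (∑ i, A i i) ^ 2 +
      ∑ i, ∑ j, (A i j * A j i - A i i * A j j) := by
  have h1 := sum_pairs (fun i j => (A j i - A i j) ^ 2) (fun i j => by ring) (by simp)
  have h2 : ∑ i, ∑ j, A j i ^ 2 = ∑ i, ∑ j, A i j ^ 2 := Finset.sum_comm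
  have h3 : (∑ i, A i i) ^ 2 = ∑ i, ∑ j, A i i * A j j := by rw [sq, Finset.sum_mul_sum]
  have h4 : ∑ i, ∑ j, (A j i - A i j) ^ 2 =
      ∑ i, ∑ j, A j i ^ 2 + ∑ i, ∑ j, A i j ^ 2 - 2 * ∑ i, ∑ j, A i j * A j i := by
    simp only [Finset.mul_sum, ← Finset.sum_add_distrib, ← Finset.sum_sub_distrib]
    refine Finset.sum_congr rfl fun i _ => Finset.sum_congr rfl fun j _ => by ring
  simp only [Finset.sum_sub_distrib]
  linarith

/-- The quadratic form `Q(A) = tr (A²) - (tr A)²` vanishes on the rank-one matrix `R = v ⊗ g`. Hence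
`Q(A) = B(A + R, A - R)` for the symmetric bilinear form `B` that belongs to `Q`. -/
theorem sum_null_lagrangian_polarized {n : ℕ} (A : Fin n → Fin n → ℝ) (v g : Fin n → ℝ) :
    ∑ i, ∑ j, (A i j * A j i - A i i * A j j) =
      ∑ i, ∑ j, ((A j i - v j * g i) * (A i j + v i * g j) -
        (A j j - v j * g j) * (A i i + v i * g i)) := by
  have h1 : ∑ i, ∑ j, A i j * (v j * g i) = ∑ i, ∑ j, A j i * (v i * g j) := Finset.sum_comm
  have h2 : ∑ i, ∑ j, A i i * (v j * g j) = ∑ i, ∑ j, A j j * (v i * g i) := Finset.sum_comm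
  have h3 : ∑ i, ∑ j, ((A j i - v j * g i) * (A i j + v i * g j) -
        (A j j - v j * g j) * (A i i + v i * g i)) =
      ∑ i, ∑ j, (A i j * A j i - A i i * A j j) +
      (∑ i, ∑ j, A j i * (v i * g j) - ∑ i, ∑ j, A i j * (v j * g i)) +
      (∑ i, ∑ j, A i i * (v j * g j) - ∑ i, ∑ j, A j j * (v i * g i)) := by
    simp only [← Finset.sum_add_distrib, ← Finset.sum_sub_distrib]
    refine Finset.sum_congr rfl fun i _ => Finset.sum_congr rfl fun j _ => by ring
  rw [h3, h1, h2]
  ring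

theorem eq_smul_of_cross_eq_zero {n : ℕ} {a b : Space n} (ha : a ≠ 0) (h : cross a b = 0) :
    b = (inner ℝ a b / ‖a‖ ^ 2) • a := by
  have hc : ∀ i j, a i * b j = a j * b i := by
    have hlt : ∀ i j, i < j → a i * b j = a j * b i := fun i j hij => by
      have := congrArg (fun z : EuclideanSpace ℝ (Pairs n) => z ⟨(i, j), hij⟩) h
      simpa [cross, sub_eq_zero] using this
    intro i j
    rcases lt_trichotomy i j with hij | rfl | hij
    · exact hlt i j hij
    · rfl
    · exact (hlt j i hij).symm
  have hn : ‖a‖ ^ 2 ≠ 0 := by simpa using ha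
  ext j
  simp only [PiLp.smul_apply, smul_eq_mul]
  rw [div_mul_eq_mul_div, eq_div_iff hn, EuclideanSpace.real_norm_sq_eq, PiLp.inner_apply,
    Finset.mul_sum, Finset.sum_mul]
  refine Finset.sum_congr rfl fun i _ => ?_
  simp only [RCLike.inner_apply, conj_trivial]
  linear_combination a i * hc i j

theorem integrableOn_of_forall_eq {n : ℕ} {Ω : Set (Space n)} (hΩ : IsOpen Ω)
    (hb : Bornology.IsBounded Ω) {f g : Space n → ℝ} (hg : ContinuousOn g (closure Ω))
    (h : ∀ x ∈ Ω, g x = f x) : IntegrableOn f Ω :=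
  ((hg.integrableOn_compact hb.isCompact_closure).mono_set subset_closure).congr_fun h
    hΩ.measurableSet

end Gaffney

/-! ### The integral identity -/

theorem mainTheorem7 (n : ℕ) (Ω : Set (Gaffney.Space n)) (hΩ_open : IsOpen Ω)
    (hΩ_bdd : Bornology.IsBounded Ω) (hΩ_lip : Gaffney.HasLipschitzBoundary Ω)
    (l : Gaffney.Space n) (hl : l ≠ 0)
    (ω : Gaffney.Space n → Gaffney.Space n) (hω : Gaffney.IsC1OnClosure Ω ω)
    (hbc : ∀ x ∈ frontier Ω, Gaffney.cross l (ω x) = 0) :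
    IntegrableOn (fun x => ‖Gaffney.grad ω x‖ ^ 2) Ω ∧
    IntegrableOn (fun x => ‖Gaffney.curl ω x‖ ^ 2 + |Gaffney.divergence ω x| ^ 2) Ω ∧
    ∫ x in Ω, ‖Gaffney.grad ω x‖ ^ 2 =
      ∫ x in Ω, (‖Gaffney.curl ω x‖ ^ 2 + |Gaffney.divergence ω x| ^ 2) := by
  obtain ⟨hωc, D, hD, hωD⟩ := hω
  set e : Fin n → Gaffney.Space n := fun j => EuclideanSpace.single j 1 with he
  set A : Gaffney.Space n → Fin n → Fin n → ℝ := fun x i j => D x (e j) i with hA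
  have hAc : ∀ i j, ContinuousOn (fun x => A x i j) (closure Ω) := fun i j =>
    (EuclideanSpace.proj (𝕜 := ℝ) i).continuous.comp_continuousOn
      (hD.clm_apply continuousOn_const)
  have hpd : ∀ x ∈ Ω, ∀ i j, Gaffney.partialDeriv ω i j x = A x i j := fun x hx i j => by
    rw [Gaffney.partialDeriv, (hωD x hx).fderiv]
  have hgrad : ∀ x ∈ Ω, ∑ i, ∑ j, A x i j ^ 2 = ‖Gaffney.grad ω x‖ ^ 2 := fun x hx => by
    rw [EuclideanSpace.real_norm_sq_eq, Fintype.sum_prod_type]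
    simp only [Gaffney.grad, hpd x hx]
  have hcd : ∀ x ∈ Ω, ∑ p : Gaffney.Pairs n, (A x p.1.2 p.1.1 - A x p.1.1 p.1.2) ^ 2 +
      (∑ i, A x i i) ^ 2 = ‖Gaffney.curl ω x‖ ^ 2 + |Gaffney.divergence ω x| ^ 2 := fun x hx => by
    rw [EuclideanSpace.real_norm_sq_eq, sq_abs]
    simp only [Gaffney.curl, Gaffney.divergence, hpd x hx]
  have hi1 : IntegrableOn (fun x => ‖Gaffney.grad ω x‖ ^ 2) Ω :=
    Gaffney.integrableOn_of_forall_eq hΩ_open hΩ_bdd (by fun_prop) hgrad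
  have hi2 : IntegrableOn
      (fun x => ‖Gaffney.curl ω x‖ ^ 2 + |Gaffney.divergence ω x| ^ 2) Ω :=
    Gaffney.integrableOn_of_forall_eq hΩ_open hΩ_bdd (by fun_prop) hcd
  refine ⟨hi1, hi2, ?_⟩
  rw [← sub_eq_zero, ← integral_sub hi1 hi2]
  -- `N ω = ω - (⟨l, ω⟩ / ‖l‖²) l` is the component of `ω` orthogonal to `l`, which is zero on `∂Ω`,
  -- and `T ω = ω + (⟨l, ω⟩ / ‖l‖²) l`. Their derivatives are `A - R` and `A + R` with
  -- `R = l ⊗ ∇(q ω)`.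
  set q : Gaffney.Space n →L[ℝ] ℝ := (‖l‖ ^ 2)⁻¹ • innerSL ℝ l with hq
  set N : Fin n → Gaffney.Space n →L[ℝ] ℝ := fun j =>
    EuclideanSpace.proj (𝕜 := ℝ) j - l j • q with hN
  set T : Fin n → Gaffney.Space n →L[ℝ] ℝ := fun i =>
    EuclideanSpace.proj (𝕜 := ℝ) i + l i • q with hT
  have hN0 : ∀ j, ∀ x ∈ frontier Ω, N j (ω x) = 0 := fun j x hx => by
    have h := congrArg (fun z : Gaffney.Space n => z j)
      (Gaffney.eq_smul_of_cross_eq_zero hl (hbc x hx))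
    simp only [PiLp.smul_apply, smul_eq_mul] at h
    simp only [hN, hq, sub_apply, smul_apply, PiLp.proj_apply, innerSL_apply_apply, smul_eq_mul]
    rw [div_eq_inv_mul] at h
    linear_combination h
  have hcomp : ∀ L : Gaffney.Space n →L[ℝ] ℝ,
      ContinuousOn (fun x => L.comp (D x)) (closure Ω) := fun L =>
    continuousOn_const.clm_comp hD
  have hwedge : ∀ i j, ∫ x in Ω, ((N j).comp (D x) (e i) * (T i).comp (D x) (e j) -
      (N j).comp (D x) (e j) * (T i).comp (D x) (e i)) = 0 := fun i j =>
    Gaffney.setIntegral_wedge_eq_zero hΩ_open hΩ_bdd (u := fun x => N j (ω x))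
      (w := fun x => T i (ω x)) ((N j).continuous.comp_continuousOn hωc) (hN0 j) (hcomp _)
      (hcomp _) (fun x hx => (N j).hasFDerivAt.comp x (hωD x hx))
      (fun x hx => (T i).hasFDerivAt.comp x (hωD x hx)) (e i) (e j)
  have hint : ∀ i j, IntegrableOn (fun x => (N j).comp (D x) (e i) * (T i).comp (D x) (e j) -
      (N j).comp (D x) (e j) * (T i).comp (D x) (e i)) Ω := fun i j =>
    Gaffney.integrableOn_of_forall_eq hΩ_open hΩ_bdd
      ((((hcomp _).clm_apply continuousOn_const).mul ((hcomp _).clm_apply continuousOn_const)).sub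
        (((hcomp _).clm_apply continuousOn_const).mul
          ((hcomp _).clm_apply continuousOn_const))) fun _ _ => rfl
  calc _ = ∫ x in Ω, ∑ i, ∑ j, ((N j).comp (D x) (e i) * (T i).comp (D x) (e j) -
      (N j).comp (D x) (e j) * (T i).comp (D x) (e i)) := by
        refine setIntegral_congr_fun hΩ_open.measurableSet fun x hx => ?_
        simp only
        rw [← hgrad x hx, ← hcd x hx, Gaffney.sum_sq_eq_curl_add_div, add_sub_cancel_left,
          Gaffney.sum_null_lagrangian_polarized (A x) l fun j => q (D x (e j))]
        simp [hN, hT, hA]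
    _ = 0 := by
        rw [integral_finsetSum _ fun i _ => integrable_finsetSum _ fun j _ => hint i j]
        refine Finset.sum_eq_zero fun i _ => ?_
        rw [integral_finsetSum _ fun j _ => hint i j]
        exact Finset.sum_eq_zero fun j _ => hwedge i j
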